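/- All graphs are finite, simple and loopless. A graph $H$ bounds a class $\mathcal C$ of graphs if every graph in $\mathcal C$ admits a homomorphism to $H$. Let $\mathcal{SP}_{2k+1}$ be the class of $K_4$-minor-free graphs of odd-girth at least $2k+1$, where the odd-girth of a graph is the length of a shortest odd cycle, and is $\infty$ if there is none. For a positive integer $k$, the augmented toroidal grid $AT(2k,2k)$ is the graph on the vertex set $\{0,1,\ldots,2k-1\}^2$ in which two vertices $(i_1,j_1)$ and $(i_2,j_2)$ are adjacent if and only if - $i_1=i_2$ and $|j_1-j_2|\in\{1,2k-1\}$, or - $j_1=j_2$ and $|i_1-i_2|\in\{1,2k-1\}$, or - $i_2-i_1+k\in\{0,2k\}$ and $j_2-j_1+k\in\{0,2k\}$. **Theorem.** For every integer $k\ge 1$, the augmented toroidal grid $AT(2k,2k)$ bounds $\mathcal{SP}_{2k+1}$. This graph has order $4k^2$, and it is the graph obtained from the toroidal grid $C_{2k}\Box C_{2k}$ (the Cartesian product of two $2k$-cycles, where $C_2$ is read as $K_2$) by joining each vertex to its antipode, that is, to the unique vertex whose distance from it in $C_{2k}\Box C_{2k}$ equals the diameter of $C_{2k}\Box C_{2k}$.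 In particular, the order of $AT(2k,2k)$ is $O(k^2)$ as $k\to\infty$. -/

import Mathlib

universe u

open Asymptotics

namespace HomBound

/-- A class of (simple, loopless) graphs. -/
abbrev GraphClass : Type (u + 1) := ∀ V : Type u, SimpleGraph V → Prop

/-- `H` bounds the class `C` if every graph in `C` admits a homomorphism to `H`. -/
def Bounds {W : Type*} (H : SimpleGraph W) (C : GraphClass.{u}) : Prop :=
  ∀ (V : Type u) (G : SimpleGraph V), C V G → Nonempty (G →g H)

/-- The odd-girth of a graph: the smallest length of an odd cycle (`⊤` if there is none). -/
noncomputable def oddGirth {V : Type*} (G : SimpleGraph V) : ℕ∞ :=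
  ⨅ (a : V) (w : G.Walk a a) (_ : w.IsCycle ∧ Odd w.length), (w.length : ℕ∞)

/-- `H` is a minor of `G`: there are pairwise disjoint, (nonempty and) connected branch sets in `G`,
one for each vertex of `H`, with an edge of `G` between the branch sets of any two adjacent
vertices of `H`. -/
def IsMinor {W V : Type*} (H : SimpleGraph W) (G : SimpleGraph V) : Prop :=
  ∃ B : W → Set V,
    (∀ w, (G.induce (B w)).Connected) ∧
    (∀ w w', w ≠ w' → Disjoint (B w) (B w')) ∧
    ∀ w w', H.Adj w w' → ∃ x ∈ B w, ∃ y ∈ B w', G.Adj x y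

/-- The class of finite `K₄`-minor-free graphs of odd-girth at least `g`. -/
def SP (g : ℕ) : GraphClass.{u} := fun V G =>
  Finite V ∧ ¬ IsMinor (SimpleGraph.completeGraph (Fin 4)) G ∧ (g : ℕ∞) ≤ oddGirth G

/-- The toroidal grid `T(a, b) = C_a □ C_b`. -/
def toroidalGrid (a b : ℕ) : SimpleGraph (Fin a × Fin b) :=
  SimpleGraph.boxProd (SimpleGraph.cycleGraph a) (SimpleGraph.cycleGraph b)

/-- Two vertices are antipodal if their distance is the diameter of the graph. -/
def IsAntipodal {V : Type*} (G : SimpleGraph V) (u v : V) : Prop :=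
  G.dist u v = G.diam

/-- The augmented toroidal grid `AT(2k, 2k)` on `{0, …, 2k - 1}²`, with its vertical, horizontal
and antipodal edges; the arithmetic is in `ℤ`. -/
def augmentedToroidalGrid (k : ℕ) : SimpleGraph (Fin (2 * k) × Fin (2 * k)) where
  Adj p q :=
    (p.1 = q.1 ∧ |((p.2 : ℕ) : ℤ) - ((q.2 : ℕ) : ℤ)| ∈ ({1, 2 * (k : ℤ) - 1} : Set ℤ)) ∨
    (p.2 = q.2 ∧ |((p.1 : ℕ) : ℤ) - ((q.1 : ℕ) : ℤ)| ∈ ({1, 2 * (k : ℤ) - 1} : Set ℤ)) ∨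
    (((q.1 : ℕ) : ℤ) - ((p.1 : ℕ) : ℤ) + k ∈ ({0, 2 * (k : ℤ)} : Set ℤ) ∧
      ((q.2 : ℕ) : ℤ) - ((p.2 : ℕ) : ℤ) + k ∈ ({0, 2 * (k : ℤ)} : Set ℤ))
  symm := ⟨by
    rintro p q (⟨h, h'⟩ | ⟨h, h'⟩ | ⟨h, h'⟩)
    · exact Or.inl ⟨h.symm, by rwa [abs_sub_comm]⟩
    · exact Or.inr (Or.inl ⟨h.symm, by rwa [abs_sub_comm]⟩)
    · simp only [Set.mem_insert_iff, Set.mem_singleton_iff] at h h' ⊢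
      exact Or.inr (Or.inr ⟨by omega, by omega⟩)⟩
  loopless := ⟨by
    rintro ⟨⟨i, hi⟩, ⟨j, hj⟩⟩ h
    simp only [Set.mem_insert_iff, Set.mem_singleton_iff, sub_self, abs_zero] at h
    omega⟩

end HomBound

namespace HomBound

open SimpleGraph

/-! For vertices `u`, `v` let `E` and `O` be the least lengths of even and odd walks between them,
capped at about `2k`. Large odd-girth gives `E + O ≥ 2k + 1`, so the interval `[2k + 1 - O, E]` is
nonempty. A label of a pair is an even `a` in this interval, realised as torus distance `a` or,
across an antipodal edge, `2k + 1 - a` (`IsAugDist`). On an edge of the graph `O ≤ 1` and `E ≤ 2k`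
force `a = 2k`, so the torus distance is `2k` or `1`, which is adjacency in the augmented grid. It
therefore suffices to place the vertices in `ℤ × ℤ` with a realised label on every edge
(`exists_torus_map`).

The placement is by induction. A nonempty `K₄`-minor-free graph has a vertex `w` of degree at most
two (`isMinor_completeGraph_four`, by longest paths). Deleting `w` and joining its neighbours `u`,
`v` yields a minor, and the old `E`, `O` are kept as abstract bounds. Given the label `a` of `uv`,
`exists_even_triangle_extension` finds labels `b`, `c` for `uw`, `vw` obeying the triangle
inequalities and `a + b + c ≤ 4k + 2`. `IsAugDist.exists_between` realises every such triple, which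
places `w`. -/

/-! ### Walks of prescribed parity and odd-girth -/

/-- Every walk can be shortened, keeping the parity of its length, to a path, unless there is an
odd cycle which is at most as long as the walk. -/
theorem exists_path_or_odd_cycle {V : Type*} {G : SimpleGraph V} {u v : V} (p : G.Walk u v) :
    (∃ q : G.Walk u v, q.IsPath ∧ q.length ≤ p.length ∧ q.length % 2 = p.length % 2) ∨
    ∃ (a : V) (c : G.Walk a a), c.IsCycle ∧ Odd c.length ∧ c.length ≤ p.length := by
  classical
  induction p with
  | nil => exact Or.inl ⟨.nil, by simp, le_rfl, rfl⟩
  | @cons u v w h p ih =>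
    rcases ih with ⟨q, hq, hl, hm⟩ | ⟨a, c, hc, ho, hl⟩
    · by_cases hu : u ∈ q.support
      · have hlen := congrArg Walk.length (q.take_spec hu)
        rw [Walk.length_append] at hlen
        -- The new edge closes the initial segment of `q` to a loop. If the loop is odd it is a
        -- genuine cycle, since an even segment is not a single edge; if even, it can be cut off
        -- without changing parity.
        by_cases hr : (q.takeUntil u hu).length % 2 = 0
        · refine Or.inr ⟨u, .cons h (q.takeUntil u hu), ?_, ?_, ?_⟩
          · rw [Walk.cons_isCycle_iff]
            refine ⟨hq.takeUntil hu, fun he => ?_⟩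
            rw [Sym2.eq_swap] at he
            have := (hq.takeUntil hu).length_eq_one_of_mem_edges he
            omega
          · rw [Walk.length_cons, Nat.odd_iff]; omega
          · simp only [Walk.length_cons]; omega
        · refine Or.inl ⟨q.dropUntil u hu, hq.dropUntil hu, ?_, ?_⟩ <;>
            simp only [Walk.length_cons] <;> omega
      · refine Or.inl ⟨.cons h q, hq.cons hu, ?_, ?_⟩ <;> simp only [Walk.length_cons] <;> omega
    · exact Or.inr ⟨a, c, hc, ho, by simp only [Walk.length_cons]; omega⟩

/-- The odd-girth is at most the length of any odd closed walk. -/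
theorem oddGirth_le_of_odd_closed_walk {V : Type*} {G : SimpleGraph V} {u : V} (p : G.Walk u u)
    (hp : Odd p.length) : oddGirth G ≤ p.length := by
  rcases exists_path_or_odd_cycle p with ⟨q, hq, -, hm⟩ | ⟨a, c, hc, ho, hl⟩
  · rw [Walk.isPath_iff_nil, ← Walk.length_eq_zero_iff] at hq
    rw [Nat.odd_iff] at hp
    omega
  · exact (iInf_le_of_le a (iInf_le_of_le c (iInf_le_of_le ⟨hc, ho⟩ le_rfl))).trans
      (by exact_mod_cast hl)

/-- The length of a shortest walk from `u` to `v` of the parity of `i`, where all integers that are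
at least `2 * k` also count as lengths. -/
noncomputable def parityDist {V : Type*} (G : SimpleGraph V) (k i : ℕ) (u v : V) : ℕ :=
  sInf {n | n % 2 = i % 2 ∧ (2 * k ≤ n ∨ ∃ p : G.Walk u v, p.length = n)}

section parityDist

variable {V : Type*} (G : SimpleGraph V) (k : ℕ)

theorem parityDist_spec (i : ℕ) (u v : V) :
    parityDist G k i u v % 2 = i % 2 ∧
      (2 * k ≤ parityDist G k i u v ∨ ∃ p : G.Walk u v, p.length = parityDist G k i u v) :=
  Nat.sInf_mem (s := {n | n % 2 = i % 2 ∧ (2 * k ≤ n ∨ ∃ p : G.Walk u v, p.length = n)})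
    ⟨2 * k + i, by omega, Or.inl (by omega)⟩

variable {G k}

theorem parityDist_le {n i : ℕ} {u v : V} (hi : n % 2 = i % 2)
    (h : 2 * k ≤ n ∨ ∃ p : G.Walk u v, p.length = n) : parityDist G k i u v ≤ n :=
  Nat.sInf_le ⟨hi, h⟩

theorem parityDist_comm (i : ℕ) (u v : V) : parityDist G k i u v = parityDist G k i v u := by
  unfold parityDist
  congr 1
  ext n
  refine and_congr_right fun _ => or_congr_right ?_
  exact ⟨fun ⟨p, hp⟩ => ⟨p.reverse, by simpa using hp⟩,
    fun ⟨p, hp⟩ => ⟨p.reverse, by simpa using hp⟩⟩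

theorem parityDist_triangle {i j l : ℕ} (h : (i + j) % 2 = l % 2) (u v w : V) :
    parityDist G k l u w ≤ parityDist G k i u v + parityDist G k j v w := by
  obtain ⟨h1, h2⟩ := parityDist_spec G k i u v
  obtain ⟨h3, h4⟩ := parityDist_spec G k j v w
  refine parityDist_le (by omega) ?_
  rcases h2 with h2 | ⟨p, hp⟩
  · exact Or.inl (by omega)
  rcases h4 with h4 | ⟨q, hq⟩
  · exact Or.inl (by omega)
  exact Or.inr ⟨p.append q, by rw [Walk.length_append, hp, hq]⟩

/-- An even and an odd walk with the same ends form an odd closed walk; if either value is at least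
`2k`, parity alone suffices. -/
theorem le_parityDist_add_parityDist (hG : ((2 * k + 1 : ℕ) : ℕ∞) ≤ oddGirth G) (u v : V) :
    2 * k + 1 ≤ parityDist G k 0 u v + parityDist G k 1 u v := by
  obtain ⟨h1, h2⟩ := parityDist_spec G k 0 u v
  obtain ⟨h3, h4⟩ := parityDist_spec G k 1 u v
  rcases h2 with h2 | ⟨p, hp⟩
  · omega
  rcases h4 with h4 | ⟨q, hq⟩
  · omega
  have := hG.trans (oddGirth_le_of_odd_closed_walk (p.append q.reverse)
    (by rw [Walk.length_append, Walk.length_reverse, Nat.odd_iff]; omega))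
  rw [Walk.length_append, Walk.length_reverse, hp, hq] at this
  exact_mod_cast this

theorem parityDist_zero_self (u : V) : parityDist G k 0 u u = 0 :=
  Nat.le_zero.1 (parityDist_le rfl (Or.inr ⟨.nil, rfl⟩))

theorem parityDist_zero_le (u v : V) : parityDist G k 0 u v ≤ 2 * k :=
  parityDist_le (by omega) (Or.inl le_rfl)

theorem parityDist_one_le_of_adj {u v : V} (h : G.Adj u v) : parityDist G k 1 u v ≤ 1 :=
  parityDist_le rfl (Or.inr ⟨h.toWalk, rfl⟩)

end parityDist

/-! ### Triangles in the torus and in its antipodal augmentation -/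

/-- `d` is the distance of the residue of `n` from `0` on the cycle `ℤ / 2k`. -/
def IsCircDist (k n d : ℤ) : Prop :=
  0 ≤ d ∧ d ≤ k ∧ ∃ m : ℤ, n = 2 * k * m + d ∨ n = 2 * k * m - d

/-- `t` is the distance of the residue of `n` from `0` on the torus `(ℤ / 2k)²`. -/
def IsTorusDist (k : ℤ) (n : ℤ × ℤ) (t : ℤ) : Prop :=
  ∃ x y : ℤ, IsCircDist k n.1 x ∧ IsCircDist k n.2 y ∧ x + y = t

/-- The four alternatives put `r` on the short arc between `0` and `n`, on the complementary arc,
beyond `n`, or beyond `0`. -/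
theorem IsCircDist.exists_between {k n x a b : ℤ} (h : IsCircDist k n x) (ha : 0 ≤ a) (hak : a ≤ k)
    (hb : 0 ≤ b) (hbk : b ≤ k)
    (hab : a + b = x ∨ a + b = 2 * k - x ∨ a = b + x ∨ b = a + x) :
    ∃ r, IsCircDist k r a ∧ IsCircDist k (n - r) b := by
  obtain ⟨hx, hxk, m, hm⟩ := h
  have pos : IsCircDist k a a := ⟨ha, hak, 0, by omega⟩
  have neg : IsCircDist k (-a) a := ⟨ha, hak, 0, by omega⟩
  have e1 : 2 * k * (m + 1) = 2 * k * m + 2 * k := by ring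
  have e2 : 2 * k * (m - 1) = 2 * k * m - 2 * k := by ring
  rcases hm with hm | hm <;> rcases hab with h | h | h | h
  · exact ⟨a, pos, hb, hbk, m, by omega⟩
  · exact ⟨-a, neg, hb, hbk, m + 1, by omega⟩
  · exact ⟨a, pos, hb, hbk, m, by omega⟩
  · exact ⟨-a, neg, hb, hbk, m, by omega⟩
  · exact ⟨-a, neg, hb, hbk, m, by omega⟩
  · exact ⟨a, pos, hb, hbk, m - 1, by omega⟩
  · exact ⟨-a, neg, hb, hbk, m, by omega⟩
  · exact ⟨a, pos, hb, hbk, m, by omega⟩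

/-- In the coordinate of larger displacement `x` the point lies on one of the two arcs; in the other
it overshoots an end, so that `|a₂ - b₂| = y`. The surplus of `s + t` is absorbed by the overshoot.
-/
theorem exists_isTorusDist_of_le {k n₁ n₂ x y s t : ℤ} (hx : IsCircDist k n₁ x)
    (hy : IsCircDist k n₂ y) (hyx : y ≤ x) (he : (x + y + s + t) % 2 = 0) (h1 : x + y ≤ s + t)
    (h2 : s ≤ t + (x + y)) (h3 : t ≤ s + (x + y)) (h4 : x + y + s + t ≤ 4 * k) :
    ∃ r₁ r₂ a₁ a₂ b₁ b₂, IsCircDist k r₁ a₁ ∧ IsCircDist k r₂ a₂ ∧ a₁ + a₂ = s ∧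
      IsCircDist k (n₁ - r₁) b₁ ∧ IsCircDist k (n₂ - r₂) b₂ ∧ b₁ + b₂ = t := by
  obtain ⟨hx0, hxk, -⟩ := id hx
  obtain ⟨hy0, hyk, -⟩ := id hy
  obtain ⟨a₁, b₁, ha₁, ha₁k, hb₁, hb₁k, hab₁, a₂, b₂, ha₂, ha₂k, hb₂, hb₂k, hab₂, hs, ht⟩ :
      ∃ a₁ b₁, 0 ≤ a₁ ∧ a₁ ≤ k ∧ 0 ≤ b₁ ∧ b₁ ≤ k ∧ (a₁ + b₁ = x ∨ a₁ + b₁ = 2 * k - x) ∧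
        ∃ a₂ b₂, 0 ≤ a₂ ∧ a₂ ≤ k ∧ 0 ≤ b₂ ∧ b₂ ≤ k ∧ (a₂ = b₂ + y ∨ b₂ = a₂ + y) ∧
          a₁ + a₂ = s ∧ b₁ + b₂ = t := by
    -- `hσ` selects the short arc exactly when the overshoot then stays within `k`; `hδ` selects the
    -- end that is overshot.
    by_cases hσ : s + t ≤ 2 * k + x - y <;> by_cases hδ : s - t ≤ x - y
    · refine ⟨(x + (s - t + y)) / 2, (x - (s - t + y)) / 2, ?_, ?_, ?_, ?_, ?_,
        (s + t - x - y) / 2, (s + t - x + y) / 2, ?_, ?_, ?_, ?_, ?_, ?_, ?_⟩ <;> omega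
    · refine ⟨(x + (s - t - y)) / 2, (x - (s - t - y)) / 2, ?_, ?_, ?_, ?_, ?_,
        (s + t - x + y) / 2, (s + t - x - y) / 2, ?_, ?_, ?_, ?_, ?_, ?_, ?_⟩ <;> omega
    · refine ⟨(2 * k - x + (s - t + y)) / 2, (2 * k - x - (s - t + y)) / 2, ?_, ?_, ?_, ?_, ?_,
        (s + t - 2 * k + x - y) / 2, (s + t - 2 * k + x + y) / 2, ?_, ?_, ?_, ?_, ?_, ?_, ?_⟩ <;>
        omega
    · refine ⟨(2 * k - x + (s - t - y)) / 2, (2 * k - x - (s - t - y)) / 2, ?_, ?_, ?_, ?_, ?_,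
        (s + t - 2 * k + x + y) / 2, (s + t - 2 * k + x - y) / 2, ?_, ?_, ?_, ?_, ?_, ?_, ?_⟩ <;>
        omega
  obtain ⟨r₁, h₁, h₁'⟩ := hx.exists_between ha₁ ha₁k hb₁ hb₁k (by omega)
  obtain ⟨r₂, h₂, h₂'⟩ := hy.exists_between ha₂ ha₂k hb₂ hb₂k (by omega)
  exact ⟨r₁, r₂, a₁, a₂, b₁, b₂, h₁, h₂, hs, h₁', h₂', ht⟩

/-- In the torus, the triangle and perimeter inequalities and the parity condition are sufficient
for the existence of a point with given distances from two given points. -/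
theorem IsTorusDist.exists_between {k d s t : ℤ} {n : ℤ × ℤ} (h : IsTorusDist k n d)
    (he : (d + s + t) % 2 = 0) (h1 : d ≤ s + t) (h2 : s ≤ t + d) (h3 : t ≤ s + d)
    (h4 : d + s + t ≤ 4 * k) : ∃ r, IsTorusDist k r s ∧ IsTorusDist k (n - r) t := by
  obtain ⟨x, y, hx, hy, rfl⟩ := h
  rcases le_total y x with hyx | hxy
  · obtain ⟨r₁, r₂, a₁, a₂, b₁, b₂, h₁, h₂, hs, h₁', h₂', ht⟩ :=
      exists_isTorusDist_of_le hx hy hyx he h1 h2 h3 h4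
    exact ⟨(r₁, r₂), ⟨a₁, a₂, h₁, h₂, hs⟩, ⟨b₁, b₂, h₁', h₂', ht⟩⟩
  · obtain ⟨r₁, r₂, a₁, a₂, b₁, b₂, h₁, h₂, hs, h₁', h₂', ht⟩ :=
      exists_isTorusDist_of_le (s := s) (t := t) hy hx hxy (by omega) (by omega) (by omega)
        (by omega) (by omega)
    exact ⟨(r₂, r₁), ⟨a₂, a₁, h₂, h₁, by omega⟩, ⟨b₂, b₁, h₂', h₁', by omega⟩⟩

/-- Up to exchanging `a` with `2k + 1 - a`, which means taking an antipodal edge, the residue of `n`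
has distance `a` from `0` on the torus `(ℤ / 2k)²`. -/
def IsAugDist (k : ℤ) (n : ℤ × ℤ) (a : ℤ) : Prop :=
  IsTorusDist k n a ∨ IsTorusDist k n (2 * k + 1 - a)

theorem IsTorusDist.bounds {k t : ℤ} {n : ℤ × ℤ} (h : IsTorusDist k n t) : 0 ≤ t ∧ t ≤ 2 * k := by
  obtain ⟨x, y, ⟨_, _, -⟩, ⟨_, _, -⟩, rfl⟩ := h
  omega

/-- Replacing two sides of a triangle by their complements to `2k + 1` preserves parity and permutes
the triangle and perimeter inequalities, up to a shift of `2`. Evenness of `a`, `b`, `c` ensures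
that one of the two choices available in each case works. -/
theorem IsAugDist.exists_between {k a b c : ℤ} {n : ℤ × ℤ} (h : IsAugDist k n a) (ha : a % 2 = 0)
    (hb : b % 2 = 0) (hc : c % 2 = 0) (h1 : a ≤ b + c) (h2 : b ≤ c + a) (h3 : c ≤ b + a)
    (h4 : a + b + c ≤ 4 * k + 2) : ∃ r, IsAugDist k r b ∧ IsAugDist k (n - r) c := by
  rcases h with h | h
  · have := h.bounds
    by_cases hp : a + b + c ≤ 4 * k
    · obtain ⟨r, hr, hr'⟩ := h.exists_between (s := b) (t := c) (by omega) (by omega) (by omega)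
        (by omega) (by omega)
      exact ⟨r, Or.inl hr, Or.inl hr'⟩
    · obtain ⟨r, hr, hr'⟩ := h.exists_between (s := 2 * k + 1 - b) (t := 2 * k + 1 - c) (by omega)
        (by omega) (by omega) (by omega) (by omega)
      exact ⟨r, Or.inr hr, Or.inr hr'⟩
  · have := h.bounds
    by_cases hp : b + 2 ≤ a + c
    · obtain ⟨r, hr, hr'⟩ := h.exists_between (s := b) (t := 2 * k + 1 - c) (by omega) (by omega)
        (by omega) (by omega) (by omega)
      exact ⟨r, Or.inl hr, Or.inr hr'⟩
    · obtain ⟨r, hr, hr'⟩ := h.exists_between (s := 2 * k + 1 - b) (t := c) (by omega) (by omega)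
        (by omega) (by omega) (by omega)
      exact ⟨r, Or.inr hr, Or.inl hr'⟩

/-! ### A `K₄` minor from minimum degree three, via longest paths -/

theorem exists_walk_support_eq_of_isChain {V : Type*} {G : SimpleGraph V} {l : List V} {x : V}
    (h : (x :: l).IsChain G.Adj) : ∃ (z : V) (p : G.Walk x z), p.support = x :: l := by
  induction l generalizing x with
  | nil => exact ⟨x, .nil, rfl⟩
  | cons y l ih =>
    rw [List.isChain_cons_cons] at h
    obtain ⟨z, p, hp⟩ := ih h.2
    exact ⟨z, .cons h.1 p, by rw [Walk.support_cons, hp]⟩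

theorem induce_connected_of_isChain {V : Type*} {G : SimpleGraph V} {l : List V}
    (h : l.IsChain G.Adj) (hl : l ≠ []) : (G.induce {v | v ∈ l}).Connected := by
  cases l with
  | nil => exact absurd rfl hl
  | cons x l =>
    obtain ⟨z, p, hp⟩ := exists_walk_support_eq_of_isChain h
    have := p.connected_induce_support
    rwa [hp] at this

/-- `l` lists the vertices of a longest path of `G`. -/
def IsLongestPath {V : Type*} (G : SimpleGraph V) (l : List V) : Prop :=
  l.Nodup ∧ l.IsChain G.Adj ∧ ∀ l' : List V, l'.Nodup → l'.IsChain G.Adj → l'.length ≤ l.length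

theorem exists_isLongestPath {V : Type*} [Finite V] (G : SimpleGraph V) :
    ∃ l, IsLongestPath G l := by
  have : Fintype V := Fintype.ofFinite V
  let s : Set ℕ := {n | ∃ l : List V, l.Nodup ∧ l.IsChain G.Adj ∧ l.length = n}
  have hs : BddAbove s := ⟨Fintype.card V, by
    rintro n ⟨l, hl, -, rfl⟩
    exact hl.length_le_card⟩
  obtain ⟨l, h1, h2, h3⟩ := Nat.sSup_mem (s := s) ⟨0, [], by simp⟩ hs
  exact ⟨l, h1, h2, fun l' h1' h2' => h3 ▸ le_csSup hs ⟨l', h1', h2', rfl⟩⟩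

section IsLongestPath

variable {V : Type*} {G : SimpleGraph V}

theorem IsLongestPath.mem_of_adj {l : List V} {x y : V} (h : IsLongestPath G (x :: l))
    (hxy : G.Adj x y) : y ∈ l := by
  obtain ⟨h1, h2, h3⟩ := h
  by_contra hy
  have := h3 (y :: x :: l) (List.nodup_cons.2 ⟨by simp [hy, hxy.ne'], h1⟩)
    (List.isChain_cons_cons.2 ⟨hxy.symm, h2⟩)
  simp at this

/-- Pósa rotation: the vertex set, hence the length, is unchanged. -/
theorem IsLongestPath.rotate {a t : List V} {x y : V}
    (h : IsLongestPath G (x :: a ++ y :: t)) (hxy : G.Adj x y) :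
    IsLongestPath G ((x :: a).reverse ++ y :: t) := by
  obtain ⟨h1, h2, h3⟩ := h
  refine ⟨?_, ?_, fun l' h1' h2' => ?_⟩
  · exact (((List.reverse_perm (x :: a)).append_right (y :: t)).nodup_iff).2 h1
  · rw [List.isChain_append] at h2 ⊢
    refine ⟨?_, h2.2.1, ?_⟩
    · rw [List.isChain_reverse]
      exact h2.1.imp fun _ _ h => h.symm
    · simpa using hxy
  · have := h3 l' h1' h2'
    simp only [List.length_append, List.length_reverse] at this ⊢
    exact this

/-- The end `x` of a longest path is joined to a later vertex of the path by a chord which spans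
`n` vertices. -/
def HasChord (G : SimpleGraph V) (n : ℕ) : Prop :=
  ∃ (x y : V) (a t : List V), IsLongestPath G (x :: a ++ y :: t) ∧ G.Adj x y ∧ a ≠ [] ∧
    a.length = n

/-- All neighbours of `x` lie on the path. A third one, besides `y` and the successor of `x`, cannot
lie before `y`, as it would give a shorter chord. -/
theorem IsLongestPath.exists_adj_mem_of_minimal (hG : ∀ w u v, ∃ x, G.Adj w x ∧ x ≠ u ∧ x ≠ v)
    {x y : V} {a t : List V} (h : IsLongestPath G (x :: a ++ y :: t)) (ha : a ≠ [])
    (hmin : ∀ n < a.length, ¬ HasChord G n) : ∃ z ∈ t, G.Adj x z := by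
  obtain ⟨a₀, a, rfl⟩ := List.exists_cons_of_ne_nil ha
  obtain ⟨z, hxz, hz₀, hzy⟩ := hG x a₀ y
  refine ⟨z, ?_, hxz⟩
  have hz := h.mem_of_adj (l := a₀ :: a ++ y :: t) hxz
  have hz' : z ∈ a ∨ z ∈ t := by simpa [hz₀, hzy] using hz
  refine hz'.resolve_left fun hza => ?_
  obtain ⟨b, c, rfl⟩ := List.append_of_mem hza
  refine hmin (a₀ :: b).length (by simp) ⟨x, z, a₀ :: b, c ++ y :: t, ?_, hxz, by simp, rfl⟩
  simpa using h

theorem exists_hasChord [Finite V] [Nonempty V]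
    (hG : ∀ w u v, ∃ x, G.Adj w x ∧ x ≠ u ∧ x ≠ v) : ∃ n, HasChord G n := by
  obtain ⟨l, hl⟩ := exists_isLongestPath G
  obtain ⟨v⟩ := ‹Nonempty V›
  cases l with
  | nil => simpa using hl.2.2 [v] (by simp) (by simp)
  | cons x l =>
    cases l with
    | nil =>
      obtain ⟨y, hy, -⟩ := hG x x x
      simpa using hl.mem_of_adj hy
    | cons x' l =>
      obtain ⟨y, hy, hy', -⟩ := hG x x' x'
      have hyl : y ∈ l := by simpa [hy'] using hl.mem_of_adj hy
      obtain ⟨b, c, rfl⟩ := List.append_of_mem hyl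
      exact ⟨_, x, y, x' :: b, c, by simpa using hl, hy, by simp, rfl⟩

/-- A finite nonempty graph of minimum degree at least three has a `K₄` minor. -/
theorem isMinor_completeGraph_four [Finite V] [Nonempty V]
    (hG : ∀ w u v, ∃ x, G.Adj w x ∧ x ≠ u ∧ x ≠ v) :
    IsMinor (SimpleGraph.completeGraph (Fin 4)) G := by
  classical
  have hex := exists_hasChord hG
  obtain ⟨x, y, a, t, h, hxy, ha, hn⟩ := Nat.find_spec hex
  have hmin : ∀ n < a.length, ¬ HasChord G n := fun n h => Nat.find_min hex (hn ▸ h)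
  obtain ⟨u, hut, hxu⟩ := h.exists_adj_mem_of_minimal hG ha hmin
  obtain ⟨a, z, rfl⟩ := List.eq_nil_or_concat' a |>.resolve_left ha
  have hrot := h.rotate hxy
  -- After rotation `z` is the end and its chord to `y` spans as many vertices as before, so
  -- minimality applies to `z` as well.
  obtain ⟨v, hvt, hzv⟩ := IsLongestPath.exists_adj_mem_of_minimal hG (x := z)
    (a := a.reverse ++ [x]) (y := y) (t := t) (by simpa using hrot) (by simp) (by simpa using hmin)
  obtain ⟨hnd, hch, -⟩ := h
  obtain ⟨t₀, t, rfl⟩ := List.exists_cons_of_ne_nil (List.ne_nil_of_mem hut)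
  have hch' : ((x :: a) ++ ([z] ++ ([y] ++ (t₀ :: t)))).IsChain G.Adj := by simpa using hch
  have hnd' : ((x :: a) ++ ([z] ++ ([y] ++ (t₀ :: t)))).Nodup := by simpa using hnd
  rw [List.isChain_append] at hch'
  obtain ⟨hc1, hch', h12⟩ := hch'
  rw [List.isChain_append] at hch'
  obtain ⟨hc2, hch', h23⟩ := hch'
  rw [List.isChain_append] at hch'
  obtain ⟨hc3, hc4, h34⟩ := hch'
  have h23 : G.Adj z y := by simpa using h23
  have h34 : G.Adj y t₀ := by simpa using h34
  obtain ⟨w, hw, hwz⟩ : ∃ w ∈ x :: a, G.Adj w z := by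
    refine ⟨(x :: a).getLast (by simp), List.getLast_mem _, h12 _ ?_ z (by simp)⟩
    rw [List.getLast?_eq_some_getLast (by simp)]
    rfl
  let B : Fin 4 → List V := ![x :: a, [z], [y], t₀ :: t]
  refine ⟨fun i => {v | v ∈ B i}, fun i => ?_, fun i j hij => ?_, fun i j hij => ?_⟩
  · refine induce_connected_of_isChain ?_ ?_ <;> fin_cases i <;> simp [B] <;> assumption
  · have key : ∀ i j : Fin 4, i < j → ∀ p ∈ B i, p ∉ B j := by
      rw [List.nodup_append, List.nodup_append, List.nodup_append] at hnd'
      obtain ⟨-, ⟨-, ⟨-, -, h34⟩, h2⟩, h1⟩ := hnd'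
      intro i j hij p hp hq
      fin_cases i <;> fin_cases j <;> first | exact absurd hij (by decide) | skip
      · exact h1 p hp p (List.mem_append_left _ hq) rfl
      · exact h1 p hp p (List.mem_append_right _ (List.mem_append_left _ hq)) rfl
      · exact h1 p hp p (List.mem_append_right _ (List.mem_append_right _ hq)) rfl
      · exact h2 p hp p (List.mem_append_left _ hq) rfl
      · exact h2 p hp p (List.mem_append_right _ hq) rfl
      · exact h34 p hp p hq rfl
    rw [Set.disjoint_left]
    intro p hp hq
    rcases lt_or_gt_of_ne hij with hlt | hlt
    · exact key i j hlt p hp hq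
    · exact key j i hlt p hq hp
  · have key : ∀ i j : Fin 4, i < j → ∃ p ∈ B i, ∃ q ∈ B j, G.Adj p q := by
      intro i j hij
      fin_cases i <;> fin_cases j <;> first | exact absurd hij (by decide) | skip
      · exact ⟨w, hw, z, by simp [B], hwz⟩
      · exact ⟨x, by simp [B], y, by simp [B], hxy⟩
      · exact ⟨x, by simp [B], u, hut, hxu⟩
      · exact ⟨z, by simp [B], y, by simp [B], h23⟩
      · exact ⟨z, by simp [B], v, hvt, hzv⟩
      · exact ⟨y, by simp [B], t₀, by simp [B], h34⟩
    rcases lt_or_gt_of_ne hij.ne with hlt | hlt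
    · exact key i j hlt
    · obtain ⟨p, hp, q, hq, hpq⟩ := key j i hlt
      exact ⟨q, hq, p, hp, hpq.symm⟩

end IsLongestPath

/-! ### Elimination of a vertex of degree at most two -/

/-- The graph obtained from `G` by deleting the vertex `w` and joining all its neighbours. -/
def eliminate {V : Type*} (G : SimpleGraph V) (w : V) : SimpleGraph {x // x ≠ w} where
  Adj x y := x ≠ y ∧ (G.Adj x y ∨ G.Adj w x ∧ G.Adj w y)
  symm := ⟨fun _ _ h => ⟨h.1.symm, h.2.imp (fun h => h.symm) (fun h => h.symm)⟩⟩
  loopless := ⟨fun _ h => h.1 rfl⟩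

/-- Eliminating a vertex of degree at most two yields a minor. -/
theorem IsMinor.of_eliminate {V W : Type*} {H : SimpleGraph W} {G : SimpleGraph V} {w u : V}
    (hw : ∀ x y, G.Adj w x → G.Adj w y → x ≠ y → x = u ∨ y = u)
    (h : IsMinor H (eliminate G w)) : IsMinor H G := by
  obtain ⟨B', hc, hd, ha⟩ := h
  -- The vertex `w` joins the branch set of `u`, if any. Every edge created by the elimination has
  -- `u` as an end, so it can be rerouted through `w`.
  let B : W → Set V := fun i => {z | (∃ h : z ≠ w, (⟨z, h⟩ : {x // x ≠ w}) ∈ B' i) ∨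
    (z = w ∧ G.Adj w u ∧ ∃ h : u ≠ w, (⟨u, h⟩ : {x // x ≠ w}) ∈ B' i)}
  have hmem : ∀ i (x : {x // x ≠ w}), x ∈ B' i → x.1 ∈ B i := fun i x hx => Or.inl ⟨x.2, hx⟩
  have hwmem : ∀ i (x : {x // x ≠ w}), x ∈ B' i → G.Adj w x → x.1 = u → w ∈ B i := by
    rintro i ⟨x, hx⟩ hxB hwx rfl
    exact Or.inr ⟨rfl, hwx, hx, hxB⟩
  have hreach : ∀ i (x y : B' i), ((eliminate G w).induce (B' i)).Reachable x y →
      (G.induce (B i)).Reachable ⟨x.1.1, hmem i _ x.2⟩ ⟨y.1.1, hmem i _ y.2⟩ := by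
    rintro i x y ⟨p⟩
    induction p with
    | nil => exact Reachable.refl _
    | @cons x y z hxy p ih =>
      refine Reachable.trans ?_ ih
      obtain ⟨hne, hxy | ⟨hx, hy⟩⟩ := hxy
      · exact Adj.reachable (G := G.induce (B i)) hxy
      · have hwB : w ∈ B i := by
          rcases hw _ _ hx hy (fun h => hne (Subtype.ext h)) with h | h
          · exact hwmem i _ x.2 hx h
          · exact hwmem i _ y.2 hy h
        exact (Adj.reachable (G := G.induce (B i)) (u := ⟨x.1.1, hmem i _ x.2⟩)
          (v := ⟨w, hwB⟩) hx.symm).trans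
          (Adj.reachable (G := G.induce (B i)) (u := ⟨w, hwB⟩) hy)
  refine ⟨B, fun i => ?_, fun i j hij => ?_, fun i j hij => ?_⟩
  · obtain ⟨x⟩ := (hc i).nonempty
    rw [connected_iff_exists_forall_reachable]
    refine ⟨⟨x.1.1, hmem i _ x.2⟩, ?_⟩
    rintro ⟨z, ⟨hz, hzB⟩ | ⟨rfl, hu, hu', huB⟩⟩
    · exact hreach i x ⟨⟨z, hz⟩, hzB⟩ ((hc i).preconnected _ _)
    · exact (hreach i x ⟨⟨u, hu'⟩, huB⟩ ((hc i).preconnected _ _)).trans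
        (Adj.reachable (G := G.induce (B i)) hu.symm)
  · have := Set.disjoint_left.1 (hd i j hij)
    rw [Set.disjoint_left]
    rintro z (⟨hz, hzB⟩ | ⟨rfl, hu, hu', huB⟩) (⟨hz', hzB'⟩ | ⟨h, -, hu'', huB'⟩)
    · exact this hzB hzB'
    · exact hz h
    · exact hz' rfl
    · exact this huB huB'
  · obtain ⟨x, hx, y, hy, hne, hxy | ⟨hwx, hwy⟩⟩ := ha i j hij
    · exact ⟨x, hmem i _ hx, y, hmem j _ hy, hxy⟩
    · rcases hw _ _ hwx hwy (fun h => hne (Subtype.ext h)) with h | h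
      · exact ⟨w, hwmem i _ hx hwx h, y, hmem j _ hy, hwy⟩
      · exact ⟨x, hmem i _ hx, w, hwmem j _ hy hwy h, hwx.symm⟩

/-- A finite graph without `K₄` minor is empty or has a vertex of degree at most two. -/
theorem exists_degree_le_two {V : Type*} [Finite V] [Nonempty V] {G : SimpleGraph V}
    (hG : ¬ IsMinor (SimpleGraph.completeGraph (Fin 4)) G) :
    ∃ w u v, ∀ x, G.Adj w x → x = u ∨ x = v := by
  by_contra! h
  exact hG (isMinor_completeGraph_four h)

/-! ### Placing the vertices on the torus -/

theorem IsAugDist.zero_zero {k : ℤ} (hk : 0 ≤ k) : IsAugDist k 0 0 :=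
  Or.inl ⟨0, 0, ⟨le_rfl, hk, 0, by simp⟩, ⟨le_rfl, hk, 0, by simp⟩, rfl⟩

theorem IsCircDist.neg {k n d : ℤ} (h : IsCircDist k n d) : IsCircDist k (-n) d := by
  obtain ⟨h0, hk, m, hm⟩ := h
  have e : 2 * k * (-m) = -(2 * k * m) := by ring
  exact ⟨h0, hk, -m, by omega⟩

theorem IsTorusDist.neg {k t : ℤ} {n : ℤ × ℤ} (h : IsTorusDist k n t) : IsTorusDist k (-n) t := by
  obtain ⟨x, y, hx, hy, h⟩ := h
  exact ⟨x, y, hx.neg, hy.neg, h⟩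

theorem IsAugDist.neg {k a : ℤ} {n : ℤ × ℤ} (h : IsAugDist k n a) : IsAugDist k (-n) a :=
  h.imp IsTorusDist.neg IsTorusDist.neg

theorem IsAugDist.nonneg {k a : ℤ} {n : ℤ × ℤ} (h : IsAugDist k n a) : 0 ≤ a := by
  rcases h with h | h <;> have := h.bounds <;> omega

/-- If the bounds `(e, o)`, `(p, P)` and `(q, Q)` for the even and odd walks between three vertices
are compatible, then an admissible even distance for the first pair extends to all three pairs. -/
theorem exists_even_triangle_extension {k a e o p P q Q : ℤ} (ha : a % 2 = 0) (ha0 : 0 ≤ a)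
    (hal : 2 * k + 1 - o ≤ a) (hau : a ≤ e) (hp : p % 2 = 0) (hP : P % 2 = 1) (hp0 : 0 ≤ p)
    (hP0 : 0 ≤ P) (hq : q % 2 = 0) (hQ : Q % 2 = 1) (hq0 : 0 ≤ q) (hQ0 : 0 ≤ Q) (he : e ≤ 2 * k)
    (hpk : p ≤ 2 * k) (h1 : e ≤ p + q) (h2 : e ≤ P + Q) (h3 : o ≤ p + Q) (h4 : o ≤ P + q)
    (h5 : 2 * k + 1 ≤ p + P) (h6 : 2 * k + 1 ≤ q + Q) :
    ∃ b c : ℤ, b % 2 = 0 ∧ 2 * k + 1 - P ≤ b ∧ b ≤ p ∧ c % 2 = 0 ∧ 2 * k + 1 - Q ≤ c ∧ c ≤ q ∧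
      a ≤ b + c ∧ b ≤ c + a ∧ c ≤ b + a ∧ a + b + c ≤ 4 * k + 2 := by
  -- Greedy choice: `b` is maximal subject to `b ≤ a + c` with `c ≤ q` and to the perimeter bound
  -- with `c ≥ 2k + 1 - Q`; then `c` is maximal given `b`.
  obtain ⟨b, hb⟩ : ∃ b, b = min p (min (a + q) (2 * k + 1 - a + Q)) := ⟨_, rfl⟩
  obtain ⟨c, hc⟩ : ∃ c, c = min q (min (a + b) (4 * k + 2 - a - b)) := ⟨_, rfl⟩
  exact ⟨b, c, by omega, by omega, by omega, by omega, by omega, by omega, by omega, by omega,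
    by omega, by omega⟩

/-- The vertices of a `K₄`-minor-free graph can be mapped to the torus such that, for any edge,
the distance of the images is compatible with given upper bounds `E` and `O` for the lengths of
even and odd walks, if these bounds satisfy the triangle inequalities and there is no odd closed
walk shorter than `2k + 1`. -/
theorem exists_torus_map (k : ℕ) (n : ℕ) : ∀ (V : Type u) [Finite V] (G : SimpleGraph V)
    (E O : V → V → ℤ), Nat.card V = n → ¬ IsMinor (SimpleGraph.completeGraph (Fin 4)) G →
    (∀ u v, E u v % 2 = 0) → (∀ u v, O u v % 2 = 1) →
    (∀ u v, E u v = E v u) → (∀ u v, O u v = O v u) → (∀ u v, 0 ≤ E u v) → (∀ u v, 0 ≤ O u v) →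
    (∀ u, E u u = 0) → (∀ u v, E u v ≤ 2 * k) →
    (∀ u v w, E u w ≤ E u v + E v w) → (∀ u v w, E u w ≤ O u v + O v w) →
    (∀ u v w, O u w ≤ E u v + O v w) →
    (∀ u v, 2 * k + 1 ≤ E u v + O u v) →
    ∃ f : V → ℤ × ℤ, ∀ u v, u = v ∨ G.Adj u v →
      ∃ a : ℤ, a % 2 = 0 ∧ 2 * k + 1 - O u v ≤ a ∧ a ≤ E u v ∧ IsAugDist k (f v - f u) a := by
  classical
  induction n with
  | zero =>
    intro V _ G E O hV
    rw [Nat.card_eq_zero] at hV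
    have : IsEmpty V := hV.resolve_right (fun h => h.false)
    intros
    exact ⟨isEmptyElim, isEmptyElim⟩
  | succ n ih =>
    intro V _ G E O hV hG hE hO hEs hOs hE0 hO0 hEE hEk hEEE hEOO hOEO hEO
    have hself : ∀ u, ∃ a : ℤ, a % 2 = 0 ∧ 2 * k + 1 - O u u ≤ a ∧ a ≤ E u u ∧
        IsAugDist k 0 a := fun u =>
      ⟨0, rfl, by have := hEO u u; have := hEE u; omega, hE0 u u, .zero_zero (by positivity)⟩
    have : Nonempty V := (Nat.card_pos_iff.1 (by omega)).1
    obtain ⟨w, u₀, v₀, hw⟩ := exists_degree_le_two hG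
    have hG' : ¬ IsMinor (SimpleGraph.completeGraph (Fin 4)) (eliminate G w) := fun h =>
      hG (h.of_eliminate (u := u₀) (by
        intro x y hx hy hxy
        rcases hw x hx with h | h
        · exact Or.inl h
        · exact Or.inr ((hw y hy).resolve_right fun h' => hxy (h.trans h'.symm))))
    have hcard : Nat.card {x // x ≠ w} = n := by
      have := Fintype.ofFinite V
      rw [Nat.card_eq_fintype_card] at hV ⊢
      rw [Fintype.card_subtype_compl, Fintype.card_subtype_eq, hV, Nat.add_sub_cancel]
    obtain ⟨f, hf⟩ := ih {x // x ≠ w} (eliminate G w) (fun x y => E x y) (fun x y => O x y) hcard hG'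
      (fun _ _ => hE _ _) (fun _ _ => hO _ _) (fun _ _ => hEs _ _) (fun _ _ => hOs _ _)
      (fun _ _ => hE0 _ _) (fun _ _ => hO0 _ _) (fun _ => hEE _) (fun _ _ => hEk _ _)
      (fun _ _ _ => hEEE _ _ _) (fun _ _ _ => hEOO _ _ _) (fun _ _ _ => hOEO _ _ _)
      (fun _ _ => hEO _ _)
    suffices hp : ∃ p : ℤ × ℤ, ∀ x : {x // x ≠ w}, G.Adj w x → ∃ a : ℤ, a % 2 = 0 ∧
        2 * k + 1 - O x w ≤ a ∧ a ≤ E x w ∧ IsAugDist k (p - f x) a by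
      obtain ⟨p, hp⟩ := hp
      refine ⟨fun x => if h : x = w then p else f ⟨x, h⟩, fun x y hxy => ?_⟩
      rcases hxy with rfl | hxy
      · simpa using hself x
      by_cases hx : x = w
      · subst hx
        obtain ⟨a, h1, h2, h3, h4⟩ := hp ⟨y, hxy.ne'⟩ hxy
        refine ⟨a, h1, by rw [hOs]; exact h2, by rw [hEs]; exact h3, ?_⟩
        have := h4.neg
        rw [neg_sub] at this
        simpa [hxy.ne'] using this
      · by_cases hy : y = w
        · subst hy
          simpa [hx] using hp ⟨x, hx⟩ hxy.symm
        · simpa [hx, hy] using hf ⟨x, hx⟩ ⟨y, hy⟩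
            (Or.inr ⟨fun h => hxy.ne (congrArg Subtype.val h), Or.inl hxy⟩)
    by_cases hn : ∃ x, G.Adj w x
    swap
    · exact ⟨0, fun x hx => absurd ⟨x.1, hx⟩ hn⟩
    -- A single neighbour is treated as `u = v`; this is why the induction statement includes equal
    -- pairs.
    obtain ⟨u, v, huv, hw⟩ : ∃ u v : {x // x ≠ w}, (u = v ∨ (eliminate G w).Adj u v) ∧
        ∀ x : {x // x ≠ w}, G.Adj w x → x = u ∨ x = v := by
      by_cases hu : G.Adj w u₀ <;> by_cases hv : G.Adj w v₀
      · refine ⟨⟨u₀, hu.ne'⟩, ⟨v₀, hv.ne'⟩, ?_, fun x hx => ?_⟩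
        · by_cases h : u₀ = v₀
          · exact Or.inl (Subtype.ext h)
          · exact Or.inr ⟨fun h' => h (congrArg Subtype.val h'), Or.inr ⟨hu, hv⟩⟩
        · exact (hw x hx).imp Subtype.ext Subtype.ext
      · refine ⟨⟨u₀, hu.ne'⟩, ⟨u₀, hu.ne'⟩, Or.inl rfl, fun x hx => Or.inl (Subtype.ext ?_)⟩
        exact (hw x hx).resolve_right (fun h => hv (h ▸ hx))
      · refine ⟨⟨v₀, hv.ne'⟩, ⟨v₀, hv.ne'⟩, Or.inl rfl, fun x hx => Or.inl (Subtype.ext ?_)⟩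
        exact (hw x hx).resolve_left (fun h => hu (h ▸ hx))
      · obtain ⟨x, hx⟩ := hn
        rcases hw x hx with rfl | rfl
        · exact absurd hx hu
        · exact absurd hx hv
    obtain ⟨a, ha, hal, hau, haf⟩ := hf u v huv
    obtain ⟨b, c, hb, hbl, hbu, hc, hcl, hcu, h1, h2, h3, h4⟩ : ∃ b c : ℤ, b % 2 = 0 ∧
        2 * k + 1 - O u w ≤ b ∧ b ≤ E u w ∧ c % 2 = 0 ∧ 2 * k + 1 - O v w ≤ c ∧ c ≤ E v w ∧
        a ≤ b + c ∧ b ≤ c + a ∧ c ≤ b + a ∧ a + b + c ≤ 4 * k + 2 :=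
      exists_even_triangle_extension ha haf.nonneg hal hau (hE _ _) (hO _ _) (hE0 _ _) (hO0 _ _)
        (hE _ _) (hO _ _) (hE0 _ _) (hO0 _ _) (hEk _ _) (hEk _ _) (by rw [hEs v w]; exact hEEE _ _ _)
        (by rw [hOs v w]; exact hEOO _ _ _) (by rw [hOs v w]; exact hOEO _ _ _)
        (by rw [add_comm, hOs u v, hOs u w]; exact hOEO _ _ _) (hEO _ _) (hEO _ _)
    obtain ⟨r, hr, hr'⟩ := haf.exists_between ha hb hc h1 h2 h3 h4
    refine ⟨f u + r, fun x hx => ?_⟩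
    rcases hw x hx with rfl | rfl
    · exact ⟨b, hb, hbl, hbu, by simpa using hr⟩
    · refine ⟨c, hc, hcl, hcu, ?_⟩
      have := hr'.neg
      rwa [show -(f x - f u - r) = f u + r - f x by abel] at this

/-! ### Distances and antipodes in the toroidal grid -/

theorem cycleGraph_adj_iff {n : ℕ} (hn : 2 ≤ n) {i j : Fin n} :
    (cycleGraph n).Adj i j ↔
      (i : ℕ) + 1 = j ∨ (j : ℕ) + 1 = i ∨ (i : ℕ) + 1 = j + n ∨ (j : ℕ) + 1 = i + n := by
  rw [cycleGraph_adj']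
  have hi := i.2
  have hj := j.2
  rcases lt_trichotomy i j with h | h | h
  · rw [Fin.coe_sub_iff_lt.2 h, Fin.coe_sub_iff_le.2 h.le]
    have : (i : ℕ) < j := h
    omega
  · subst h
    have : NeZero n := ⟨by omega⟩
    simp
    omega
  · rw [Fin.coe_sub_iff_lt.2 h, Fin.coe_sub_iff_le.2 h.le]
    have : (j : ℕ) < i := h
    omega

/-- The distance of `i` and `j` on a cycle with vertices `0, …, n - 1`. -/
def cycleDist {n : ℕ} (i j : Fin n) : ℕ :=
  min ((i - j : ℕ) + (j - i : ℕ)) (n - ((i - j : ℕ) + (j - i : ℕ)))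

theorem cycleDist_le_length {n : ℕ} (hn : 2 ≤ n) {i j : Fin n} (p : (cycleGraph n).Walk i j) :
    cycleDist i j ≤ p.length := by
  induction p with
  | nil => simp [cycleDist]
  | @cons i j l h p ih =>
    rw [cycleGraph_adj_iff hn] at h
    rw [Walk.length_cons]
    unfold cycleDist at *
    omega

theorem exists_walk_length_eq_cycleDist {n : ℕ} (hn : 2 ≤ n) (d : ℕ) : ∀ i j : Fin n,
    cycleDist i j = d → ∃ p : (cycleGraph n).Walk i j, p.length = d := by
  induction d with
  | zero =>
    intro i j h
    obtain rfl : i = j := by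
      unfold cycleDist at h
      ext
      omega
    exact ⟨.nil, rfl⟩
  | succ d ih =>
    intro i j h
    have hi := i.2
    have hj := j.2
    obtain ⟨l, hl, hd⟩ : ∃ l : Fin n, (cycleGraph n).Adj i l ∧ cycleDist l j = d := by
      simp only [cycleGraph_adj_iff hn, cycleDist] at h ⊢
      suffices ∃ l : ℕ, l < n ∧ ((i : ℕ) + 1 = l ∨ l + 1 = i ∨ (i : ℕ) + 1 = l + n ∨ l + 1 = i + n) ∧
          min ((l - j : ℕ) + (j - l : ℕ)) (n - ((l - j : ℕ) + (j - l : ℕ))) = d by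
        obtain ⟨l, hl, h⟩ := this
        exact ⟨⟨l, hl⟩, h⟩
      -- Step from `i` towards `j` along a shorter arc, wrapping around at `0` or `n - 1`.
      by_cases hij : (i : ℕ) < j <;> by_cases hs : (i - j : ℕ) + (j - i : ℕ) ≤ n / 2
      · exact ⟨i + 1, by omega, by omega, by omega⟩
      · by_cases h0 : (i : ℕ) = 0
        · exact ⟨n - 1, by omega, by omega, by omega⟩
        · exact ⟨i - 1, by omega, by omega, by omega⟩
      · exact ⟨i - 1, by omega, by omega, by omega⟩
      · by_cases h0 : (i : ℕ) = n - 1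
        · exact ⟨0, by omega, by omega, by omega⟩
        · exact ⟨i + 1, by omega, by omega, by omega⟩
    obtain ⟨p, hp⟩ := ih l j hd
    exact ⟨.cons hl p, by rw [Walk.length_cons, hp]⟩

theorem edist_cycleGraph {n : ℕ} (hn : 2 ≤ n) (i j : Fin n) :
    (cycleGraph n).edist i j = cycleDist i j := by
  obtain ⟨p, hp⟩ := exists_walk_length_eq_cycleDist hn _ i j rfl
  refine le_antisymm (hp ▸ edist_le p) ?_
  obtain ⟨q, hq⟩ := p.reachable.exists_walk_length_eq_edist
  rw [← hq]
  exact_mod_cast cycleDist_le_length hn q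

theorem edist_toroidalGrid {a b : ℕ} (ha : 2 ≤ a) (hb : 2 ≤ b) (p q : Fin a × Fin b) :
    (toroidalGrid a b).edist p q = (cycleDist p.1 q.1 + cycleDist p.2 q.2 : ℕ) := by
  rw [toroidalGrid, edist_boxProd, edist_cycleGraph ha, edist_cycleGraph hb, Nat.cast_add]

theorem cycleDist_le {k : ℕ} (i j : Fin (2 * k)) : cycleDist i j ≤ k := by
  unfold cycleDist
  omega

theorem diam_toroidalGrid {k : ℕ} (hk : 1 ≤ k) : (toroidalGrid (2 * k) (2 * k)).diam = 2 * k := by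
  have h : (toroidalGrid (2 * k) (2 * k)).ediam = (2 * k : ℕ) := by
    refine le_antisymm (ediam_le_of_edist_le fun p q => ?_) ?_
    · rw [edist_toroidalGrid (by omega) (by omega)]
      have h1 := cycleDist_le p.1 q.1
      have h2 := cycleDist_le p.2 q.2
      exact_mod_cast (by omega : cycleDist p.1 q.1 + cycleDist p.2 q.2 ≤ 2 * k)
    · refine le_trans ?_ (edist_le_ediam (u := (⟨0, by omega⟩, ⟨0, by omega⟩))
        (v := (⟨k, by omega⟩, ⟨k, by omega⟩)))
      rw [edist_toroidalGrid (by omega) (by omega)]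
      exact_mod_cast (by simp only [cycleDist]; omega)
  rw [diam, h, ENat.toNat_natCast]

theorem isAntipodal_toroidalGrid_iff {k : ℕ} (hk : 1 ≤ k) {p q : Fin (2 * k) × Fin (2 * k)} :
    IsAntipodal (toroidalGrid (2 * k) (2 * k)) p q ↔
      cycleDist p.1 q.1 = k ∧ cycleDist p.2 q.2 = k := by
  rw [IsAntipodal, diam_toroidalGrid hk, SimpleGraph.dist, edist_toroidalGrid (by omega) (by omega),
    ENat.toNat_natCast]
  have h1 := cycleDist_le p.1 q.1
  have h2 := cycleDist_le p.2 q.2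
  omega

theorem existsUnique_cycleDist_eq {k : ℕ} (hk : 1 ≤ k) (i : Fin (2 * k)) :
    ∃! j, cycleDist i j = k := by
  have hi := i.2
  by_cases h : (i : ℕ) < k
  · refine ⟨⟨i + k, by omega⟩, by simp only [cycleDist]; omega, fun j hj => ?_⟩
    simp only [cycleDist] at hj
    ext
    simp only
    omega
  · refine ⟨⟨i - k, by omega⟩, by simp only [cycleDist]; omega, fun j hj => ?_⟩
    simp only [cycleDist] at hj
    ext
    simp only
    omega

theorem existsUnique_isAntipodal {k : ℕ} (hk : 1 ≤ k) (p : Fin (2 * k) × Fin (2 * k)) :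
    ∃! q, IsAntipodal (toroidalGrid (2 * k) (2 * k)) p q := by
  obtain ⟨i, hi, hi'⟩ := existsUnique_cycleDist_eq hk p.1
  obtain ⟨j, hj, hj'⟩ := existsUnique_cycleDist_eq hk p.2
  refine ⟨(i, j), (isAntipodal_toroidalGrid_iff hk).2 ⟨hi, hj⟩, fun q hq => ?_⟩
  replace hq := (isAntipodal_toroidalGrid_iff hk).1 hq
  exact Prod.ext (hi' _ hq.1) (hj' _ hq.2)

theorem augmentedToroidalGrid_adj_iff {k : ℕ} (hk : 1 ≤ k) (p q : Fin (2 * k) × Fin (2 * k)) :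
    (augmentedToroidalGrid k).Adj p q ↔
      (toroidalGrid (2 * k) (2 * k)).Adj p q ∨
        IsAntipodal (toroidalGrid (2 * k) (2 * k)) p q := by
  rw [isAntipodal_toroidalGrid_iff hk, toroidalGrid, boxProd_adj, cycleGraph_adj_iff (by omega),
    cycleGraph_adj_iff (by omega)]
  obtain ⟨⟨i, hi⟩, ⟨j, hj⟩⟩ := p
  obtain ⟨⟨i', hi'⟩, ⟨j', hj'⟩⟩ := q
  simp only [augmentedToroidalGrid, cycleDist, Set.mem_insert_iff, Set.mem_singleton_iff,
    Fin.mk.injEq, abs_eq_max_neg]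
  omega

/-! ### From integer coordinates to the homomorphism -/

theorem IsCircDist.cycleDist_eq {k : ℕ} {i j : Fin (2 * k)} {d : ℤ}
    (h : IsCircDist k ((j : ℕ) - (i : ℕ) : ℤ) d) : (cycleDist i j : ℤ) = d := by
  obtain ⟨h0, hk, m, hm⟩ := h
  have hi := i.2
  have hj := j.2
  -- Representatives differ by less than `2k`, so only `m = -1, 0, 1` can occur; this makes the goal
  -- linear.
  have hm1 : m < 2 := by
    by_contra! hm2
    have := mul_le_mul_of_nonneg_left hm2 (show (0 : ℤ) ≤ 2 * k by positivity)
    omega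
  have hm2 : -2 < m := by
    by_contra! hm2
    have := mul_le_mul_of_nonneg_left hm2 (show (0 : ℤ) ≤ 2 * k by positivity)
    omega
  simp only [cycleDist]
  obtain rfl | rfl | rfl : m = -1 ∨ m = 0 ∨ m = 1 := by omega
  all_goals omega

theorem IsCircDist.add_mul {k n d : ℤ} (h : IsCircDist k n d) (m : ℤ) :
    IsCircDist k (n + 2 * k * m) d := by
  obtain ⟨h0, hk, m', hm⟩ := h
  exact ⟨h0, hk, m' + m, by rw [mul_add]; omega⟩

theorem exists_fin_eq_add_mul {k : ℕ} (hk : 1 ≤ k) (n : ℤ) :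
    ∃ (i : Fin (2 * k)) (m : ℤ), ((i : ℕ) : ℤ) = n + 2 * k * m := by
  have h0 := Int.emod_nonneg n (b := 2 * k) (by omega)
  have h1 := Int.emod_lt_of_pos n (b := 2 * k) (by omega)
  have h2 := Int.emod_add_mul_ediv n (2 * k)
  refine ⟨⟨(n % (2 * k)).toNat, by omega⟩, -(n / (2 * k)), ?_⟩
  rw [mul_neg]
  simp only
  omega

theorem bounds_augmentedToroidalGrid {k : ℕ} (hk : 1 ≤ k) :
    Bounds (augmentedToroidalGrid k) (SP.{u} (2 * k + 1)) := by
  rintro V G ⟨_, hG, hodd⟩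
  obtain ⟨f, hf⟩ := exists_torus_map k _ V G (fun u v => parityDist G k 0 u v)
    (fun u v => parityDist G k 1 u v) rfl hG
    (fun u v => by have := (parityDist_spec G k 0 u v).1; omega)
    (fun u v => by have := (parityDist_spec G k 1 u v).1; omega)
    (fun u v => by rw [parityDist_comm]) (fun u v => by rw [parityDist_comm])
    (fun _ _ => by positivity) (fun _ _ => by positivity)
    (fun u => by exact_mod_cast parityDist_zero_self u)
    (fun u v => by exact_mod_cast parityDist_zero_le u v)
    (fun u v w => by exact_mod_cast parityDist_triangle (i := 0) (j := 0) (l := 0) rfl u v w)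
    (fun u v w => by exact_mod_cast parityDist_triangle (i := 1) (j := 1) (l := 0) rfl u v w)
    (fun u v w => by exact_mod_cast parityDist_triangle (i := 0) (j := 1) (l := 1) rfl u v w)
    (fun u v => by exact_mod_cast le_parityDist_add_parityDist hodd u v)
  choose r m hr using exists_fin_eq_add_mul hk
  have hcirc : ∀ {a b d : ℤ}, IsCircDist k (b - a) d → (cycleDist (r a) (r b) : ℤ) = d := by
    intro a b d h
    refine IsCircDist.cycleDist_eq ?_
    have e : (((r b : ℕ) : ℤ) - ((r a : ℕ) : ℤ)) = b - a + 2 * k * (m b - m a) := by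
      rw [hr, hr]; ring
    rw [e]
    exact h.add_mul _
  refine ⟨fun v => (r (f v).1, r (f v).2), fun {u v} huv => ?_⟩
  obtain ⟨a, ha, hal, hau, haf⟩ := hf u v (Or.inr huv)
  -- These bounds squeeze the label of an edge to `a = 2k`, whose complement is `1`.
  have hO : (parityDist G k 1 u v : ℤ) ≤ 1 := by exact_mod_cast parityDist_one_le_of_adj huv
  have hE : (parityDist G k 0 u v : ℤ) ≤ 2 * k := by exact_mod_cast parityDist_zero_le u v
  have : ∃ x y, IsCircDist k ((f v).1 - (f u).1) x ∧ IsCircDist k ((f v).2 - (f u).2) y ∧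
      (x + y = 2 * k ∨ x + y = 1) := by
    rcases haf with ⟨x, y, hx, hy, hxy⟩ | ⟨x, y, hx, hy, hxy⟩
    · exact ⟨x, y, hx, hy, by omega⟩
    · exact ⟨x, y, hx, hy, by omega⟩
  obtain ⟨x, y, hx, hy, hxy⟩ := this
  have hx' := hcirc hx
  have hy' := hcirc hy
  have h1 := cycleDist_le (r (f u).1) (r (f v).1)
  have h2 := cycleDist_le (r (f u).2) (r (f v).2)
  rw [augmentedToroidalGrid_adj_iff hk, isAntipodal_toroidalGrid_iff hk, toroidalGrid, boxProd_adj,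
    cycleGraph_adj_iff (by omega), cycleGraph_adj_iff (by omega)]
  simp only [Fin.ext_iff]
  simp only [cycleDist] at *
  omega

end HomBound

theorem mainTheorem4 :
    (∀ k : ℕ, 1 ≤ k →
      HomBound.Bounds (HomBound.augmentedToroidalGrid k) (HomBound.SP.{u} (2 * k + 1)) ∧
      Nat.card (Fin (2 * k) × Fin (2 * k)) = 4 * k ^ 2 ∧
      (∀ p : Fin (2 * k) × Fin (2 * k),
        ∃! q, HomBound.IsAntipodal (HomBound.toroidalGrid (2 * k) (2 * k)) p q) ∧
      (∀ p q : Fin (2 * k) × Fin (2 * k),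
        (HomBound.augmentedToroidalGrid k).Adj p q ↔
          (HomBound.toroidalGrid (2 * k) (2 * k)).Adj p q ∨
          HomBound.IsAntipodal (HomBound.toroidalGrid (2 * k) (2 * k)) p q)) ∧
    (fun k : ℕ => (Nat.card (Fin (2 * k) × Fin (2 * k)) : ℝ))
      =O[Filter.atTop] (fun k : ℕ => (k : ℝ) ^ 2) := by
  have hcard : ∀ k : ℕ, Nat.card (Fin (2 * k) × Fin (2 * k)) = 4 * k ^ 2 := by
    intro k
    rw [Nat.card_prod, Nat.card_eq_fintype_card, Fintype.card_fin]
    ring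
  refine ⟨fun k hk => ⟨HomBound.bounds_augmentedToroidalGrid hk, hcard k,
    HomBound.existsUnique_isAntipodal hk, HomBound.augmentedToroidalGrid_adj_iff hk⟩, ?_⟩
  refine Asymptotics.IsBigO.of_bound 4 (Filter.Eventually.of_forall fun k => ?_)
  rw [hcard]
  simp
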